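/- Let $n\ge 2$, let $S_n$ be the space of real symmetric $n\times n$ matrices, and let $A:S_n\to S_n$ be a linear map. Let $x=(x_1,\dots,x_n)$, $y=(y_1,\dots,y_n)$ and $\alpha=(\alpha_1,\dots,\alpha_{n-1})$ be tuples of commuting variables, and put $$p_A(x,y)=y^TA(xx^T)y\in\mathbb R[x,y].$$ Let $I\subseteq\mathbb R[x,y]$ be the ideal generated by $x^Ty=\sum_{i=1}^n x_iy_i$. Let $q_A=p_A\circ\Psi\in\mathbb R[x,\alpha]$, where $\Psi(x,\alpha)=(x,y)$ with $$y_1=\alpha_1x_2,\qquad y_i=\alpha_ix_{i+1}-\alpha_{i-1}x_{i-1}\ \ (2\le i\le n-1),\qquad y_n=-\alpha_{n-1}x_{n-1}.$$ A linear map $\Phi:M_n(\mathbb R)\to M_n(\mathbb R)$ is called completely cross-positive if $\Phi(U^T)=\Phi(U)^T$ for all $U\in M_n(\mathbb R)$ and, for every $k\in\mathbb N$ and all positive semidefinite symmetric $U,V\in M_k(\mathbb R)\otimes M_n(\mathbb R)$, $\langle U,V\rangle=0$ implies $\langle (I_k\otimes\Phi)(U),V\rangle\ge 0$; here $\langle B,C\rangle=\operatorname{Tr}(C^TB)$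 and $I_k\otimes\Phi$ is the linear map with $U\otimes V\mapsto U\otimes\Phi(V)$. Then the following are equivalent: 1. there is a completely cross-positive map $\widetilde A:M_n(\mathbb R)\to M_n(\mathbb R)$ whose restriction to $S_n$ is $A$; 2. $p_A$ is a sum of squares modulo $I$, i.e. $p_A=\sum_{i=1}^m p_i^2+r$ for some $p_1,\dots,p_m\in\mathbb R[x,y]$ and $r\in I$; 3. $q_A$ is a sum of squares of polynomials in $\mathbb R[x,\alpha]$. -/

import Mathlib

open MvPolynomial
open scoped Matrix Kronecker

noncomputable section

/-- The real vector space `S_n` of symmetric `n × n` real matrices. -/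
def symMat (n : ℕ) : Submodule ℝ (Matrix (Fin n) (Fin n) ℝ) where
  carrier := {M | Mᵀ = M}
  add_mem' := by
    intro M N hM hN
    simp only [Set.mem_ofPred_eq] at hM hN ⊢
    rw [Matrix.transpose_add, hM, hN]
  zero_mem' := by simp
  smul_mem' := by
    intro c M hM
    simp only [Set.mem_ofPred_eq] at hM ⊢
    rw [Matrix.transpose_smul, hM]

/-- The ampliation `I_k ⊗ Φ`, which applies `Φ` to each of the `k × k` blocks (of size `n × n`)
of a matrix with rows and columns indexed by `Fin k × Fin n`. -/
def ampliation {n : ℕ} (k : ℕ)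
    (Φ : Matrix (Fin n) (Fin n) ℝ →ₗ[ℝ] Matrix (Fin n) (Fin n) ℝ) :
    Matrix (Fin k × Fin n) (Fin k × Fin n) ℝ →ₗ[ℝ]
      Matrix (Fin k × Fin n) (Fin k × Fin n) ℝ where
  toFun U := Matrix.of fun a b =>
    Φ (Matrix.of fun i j => U (a.1, i) (b.1, j)) a.2 b.2
  map_add' U V := by
    ext a b
    exact congrFun (congrFun (Φ.map_add (Matrix.of fun i j => U (a.1, i) (b.1, j))
      (Matrix.of fun i j => V (a.1, i) (b.1, j))) a.2) b.2
  map_smul' c U := by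
    ext a b
    exact congrFun (congrFun (Φ.map_smul c (Matrix.of fun i j => U (a.1, i) (b.1, j))) a.2) b.2

/-- `(I_k ⊗ Φ)(U ⊗ V) = U ⊗ Φ(V)`. -/
theorem ampliation_kronecker {n : ℕ} (k : ℕ)
    (Φ : Matrix (Fin n) (Fin n) ℝ →ₗ[ℝ] Matrix (Fin n) (Fin n) ℝ)
    (U : Matrix (Fin k) (Fin k) ℝ) (V : Matrix (Fin n) (Fin n) ℝ) :
    ampliation k Φ (U ⊗ₖ V) = U ⊗ₖ Φ V := by
  ext a b
  exact congrFun (congrFun (Φ.map_smul (U a.1 b.1) V) a.2) b.2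

/-- A linear map `Φ` on `M_n(ℝ)` is completely cross-positive if it is `*`-linear and, for all `k`
and all positive semidefinite `U, V` of size `kn`, `⟨U, V⟩ = 0` implies `⟨(I_k ⊗ Φ)(U), V⟩ ≥ 0`,
where `⟨B, C⟩ = Tr(Cᵀ B)`. -/
def IsCompletelyCrossPositive {n : ℕ}
    (Φ : Matrix (Fin n) (Fin n) ℝ →ₗ[ℝ] Matrix (Fin n) (Fin n) ℝ) : Prop :=
  (∀ U, Φ Uᵀ = (Φ U)ᵀ) ∧
  ∀ (k : ℕ) (U V : Matrix (Fin k × Fin n) (Fin k × Fin n) ℝ),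
    U.PosSemidef → V.PosSemidef → (Vᵀ * U).trace = 0 → 0 ≤ (Vᵀ * ampliation k Φ U).trace

/-- The symmetric matrix `(E_ij + E_ji) / 2`. -/
def symUnit {n : ℕ} (i j : Fin n) : symMat n :=
  ⟨(2⁻¹ : ℝ) • (Matrix.single i j (1 : ℝ) + Matrix.single j i (1 : ℝ)), by
    change _ᵀ = _
    rw [Matrix.transpose_smul, Matrix.transpose_add, Matrix.transpose_single,
      Matrix.transpose_single, add_comm]⟩

/-- The biquadratic form `p_A = yᵀ A(x xᵀ) y` in `ℝ[x, y]`. The variables `Sum.inl i` are the `x_i`,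
the variables `Sum.inr i` are the `y_i`, and `x xᵀ = ∑ i j, x_i x_j (E_ij + E_ji) / 2`. -/
def pForm {n : ℕ} (A : symMat n →ₗ[ℝ] symMat n) : MvPolynomial (Fin n ⊕ Fin n) ℝ :=
  ∑ k, ∑ l, (∑ i, ∑ j, C ((A (symUnit i j)).1 k l) * (X (Sum.inl i) * X (Sum.inl j))) *
    (X (Sum.inr k) * X (Sum.inr l))

/-- The symmetric matrix `x xᵀ` of a real vector `x`. -/
def rankOne {n : ℕ} (x : Fin n → ℝ) : symMat n :=
  ⟨Matrix.vecMulVec x x, by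
    change _ᵀ = _
    rw [Matrix.transpose_vecMulVec]⟩

theorem rankOne_eq_sum {n : ℕ} (x : Fin n → ℝ) :
    rankOne x = ∑ i, ∑ j, (x i * x j) • symUnit i j := by
  apply Subtype.ext
  ext a b
  simp only [rankOne, symUnit, Matrix.vecMulVec_apply, AddSubmonoidClass.coe_finsetSum,
    Submodule.coe_smul, Matrix.sum_apply, Matrix.smul_apply, Matrix.add_apply, smul_eq_mul,
    Matrix.single_apply, ite_and, mul_add, mul_ite, mul_one, mul_zero, Finset.sum_add_distrib,
    Finset.sum_ite_eq', Finset.mem_univ, if_true, Finset.sum_ite_irrel, Finset.sum_const_zero]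
  ring

/-- As a function on `ℝⁿ × ℝⁿ`, `p_A(x, y) = yᵀ A(x xᵀ) y`. -/
theorem eval_pForm {n : ℕ} (A : symMat n →ₗ[ℝ] symMat n) (x y : Fin n → ℝ) :
    eval (Sum.elim x y) (pForm A) = y ⬝ᵥ ((A (rankOne x)).1 *ᵥ y) := by
  simp only [rankOne_eq_sum, map_sum, map_smul, pForm, map_mul, eval_C, eval_X, Sum.elim_inl,
    Sum.elim_inr, dotProduct, Matrix.mulVec, AddSubmonoidClass.coe_finsetSum,
    Submodule.coe_smul, Matrix.sum_apply, Matrix.smul_apply, smul_eq_mul, Finset.mul_sum,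
    Finset.sum_mul]
  refine Finset.sum_congr rfl fun k _ => Finset.sum_congr rfl fun l _ =>
    Finset.sum_congr rfl fun i _ => Finset.sum_congr rfl fun j _ => ?_
  ring

/-- The ideal `I` of `ℝ[x, y]` generated by `yᵀ x = ∑ i, x_i y_i`. -/
def orthIdeal (n : ℕ) : Ideal (MvPolynomial (Fin n ⊕ Fin n) ℝ) :=
  Ideal.span {∑ i : Fin n, X (Sum.inl i) * X (Sum.inr i)}

/-- The polynomials in `ℝ[x, α]` (`Sum.inl i` is `x_i`, `Sum.inr i` is `α_i`) that the substitution
`Ψ` puts in the place of `x` and `y`: it fixes `x`, and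
`y_i = α_i x_{i+1} - α_{i-1} x_{i-1}`, where for the first index only the first term is present and
for the last index only the second one. -/
def psi (n : ℕ) : Fin n ⊕ Fin n → MvPolynomial (Fin n ⊕ Fin (n - 1)) ℝ :=
  Sum.elim (fun i => X (Sum.inl i)) fun i =>
    (if h : i.1 + 1 < n then X (Sum.inr ⟨i.1, by omega⟩) * X (Sum.inl ⟨i.1 + 1, h⟩) else 0) -
    (if h : 0 < i.1 then X (Sum.inr ⟨i.1 - 1, by omega⟩) * X (Sum.inl ⟨i.1 - 1, by omega⟩) else 0)

/-- The form `q_A = p_A ∘ Ψ` in `ℝ[x, α]`. -/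
def qForm {n : ℕ} (A : symMat n →ₗ[ℝ] symMat n) : MvPolynomial (Fin n ⊕ Fin (n - 1)) ℝ :=
  aeval (psi n) (pForm A)

end

/-!
The equivalence goes through an explicit description of the maps in question: a map `A` on `S_n`
extends to a completely cross-positive map exactly if
`A(X) = ∑ C_i X C_iᵀ + K X + X Kᵀ` for some matrices `C_i` and `K`.

* Such maps are completely cross-positive, because positive semidefinite `U, V` with `⟨U, V⟩ = 0`
  satisfy `V U = 0` (`isCompletelyCrossPositive_lindbladMap`).
* If `Φ` is completely cross-positive, testing with `U = vec(1) vec(1)ᵀ` and `V = vec(B) vec(B)ᵀ`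
  shows that its Choi matrix is nonnegative on traceless `B`. Hence the Choi form is a sum of
  squares of linear forms modulo the trace form. Substituting `B = x yᵀ`, whose trace is `xᵀ y`,
  writes `p_A` as a sum of squares modulo `I` (`exists_isSumSq_sub_mem_orthIdeal`).
* The substitution `Ψ` parametrizes vectors `y` orthogonal to `x`, so it kills `I`
  (`aeval_psi_eq_zero_of_mem_orthIdeal`), and `q_A` is a sum of squares if `p_A` is one modulo `I`.
* Let `q_A = ∑ q_i²`. Each `q_i² ≤ q_A`, and comparing growth under dilations of `x` and of `α`
  shows that `q_i` is quadratic in `x` and linear in `α`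
  (`MvPolynomial.isWeightedHomogeneous_of_sq_le`). Moreover `q_i` vanishes wherever `y(x, α)` does.
  At generic `x` this says nothing, but at points with a vanishing coordinate it gives congruences
  between the coefficients of the `α_k`, which force `q_i = yᵀ C_i x` for a matrix `C_i`
  (`exists_linear_of_vanishing`). Then `D(x) = A(x xᵀ) - ∑ C_i x xᵀ C_iᵀ` satisfies `yᵀ D(x) y = 0`
  for generic `x` and all `y` orthogonal to `x`, so `D(x) = K x xᵀ + x xᵀ Kᵀ`
  (`exists_eq_symm_product`), and `A` has the required shape.
-/

/-! ### Maps of the form `X ↦ ∑ C_i X C_iᵀ + K X + X Kᵀ` -/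

/-- The map `X ↦ ∑ i, C_i X C_iᵀ + K X + X Kᵀ`. -/
noncomputable def lindbladMap {n : ℕ} {ι : Type*} [Fintype ι] (C : ι → Matrix (Fin n) (Fin n) ℝ)
    (K : Matrix (Fin n) (Fin n) ℝ) :
    Matrix (Fin n) (Fin n) ℝ →ₗ[ℝ] Matrix (Fin n) (Fin n) ℝ where
  toFun X := ∑ i, C i * X * (C i)ᵀ + (K * X + X * Kᵀ)
  map_add' X Y := by
    simp only [mul_add, add_mul, Finset.sum_add_distrib]
    abel
  map_smul' c X := by
    simp [Finset.smul_sum]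

theorem lindbladMap_apply {n : ℕ} {ι : Type*} [Fintype ι] (C : ι → Matrix (Fin n) (Fin n) ℝ)
    (K X : Matrix (Fin n) (Fin n) ℝ) :
    lindbladMap C K X = ∑ i, C i * X * (C i)ᵀ + (K * X + X * Kᵀ) := rfl

theorem one_kronecker_mul_apply {n k : ℕ} (K : Matrix (Fin n) (Fin n) ℝ)
    (U : Matrix (Fin k × Fin n) (Fin k × Fin n) ℝ) (a b : Fin k × Fin n) :
    (((1 : Matrix (Fin k) (Fin k) ℝ) ⊗ₖ K) * U) a b =
      (K * Matrix.of fun i j => U (a.1, i) (b.1, j)) a.2 b.2 := by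
  simp [Matrix.mul_apply, Fintype.sum_prod_type, Matrix.one_apply, ite_mul]

theorem mul_one_kronecker_transpose_apply {n k : ℕ} (K : Matrix (Fin n) (Fin n) ℝ)
    (U : Matrix (Fin k × Fin n) (Fin k × Fin n) ℝ) (a b : Fin k × Fin n) :
    (U * ((1 : Matrix (Fin k) (Fin k) ℝ) ⊗ₖ K)ᵀ) a b =
      ((Matrix.of fun i j => U (a.1, i) (b.1, j)) * Kᵀ) a.2 b.2 := by
  simp [Matrix.mul_apply, Fintype.sum_prod_type, Matrix.one_apply]

theorem ampliation_lindbladMap {n : ℕ} {ι : Type*} [Fintype ι]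
    (C : ι → Matrix (Fin n) (Fin n) ℝ) (K : Matrix (Fin n) (Fin n) ℝ) (k : ℕ)
    (U : Matrix (Fin k × Fin n) (Fin k × Fin n) ℝ) :
    ampliation k (lindbladMap C K) U =
      ∑ i, (1 ⊗ₖ C i) * U * ((1 : Matrix (Fin k) (Fin k) ℝ) ⊗ₖ C i)ᵀ +
        ((1 ⊗ₖ K) * U + U * ((1 : Matrix (Fin k) (Fin k) ℝ) ⊗ₖ K)ᵀ) := by
  ext a b
  change lindbladMap C K _ a.2 b.2 = _
  simp only [lindbladMap_apply, Matrix.add_apply, Matrix.sum_apply, one_kronecker_mul_apply,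
    mul_one_kronecker_transpose_apply]
  congr 1

open scoped MatrixOrder in
theorem Matrix.PosSemidef.exists_transpose_mul_self {m : Type*} [Fintype m] [DecidableEq m]
    {U : Matrix m m ℝ} (hU : U.PosSemidef) : ∃ N : Matrix m m ℝ, U = Nᵀ * N := by
  obtain ⟨N, hN⟩ := CStarAlgebra.nonneg_iff_eq_star_mul_self.mp hU.nonneg
  exact ⟨N, by simpa [Matrix.star_eq_conjTranspose] using hN⟩

theorem Matrix.PosSemidef.trace_mul_nonneg {m : Type*} [Fintype m] [DecidableEq m]
    {U V : Matrix m m ℝ} (hU : U.PosSemidef) (hV : V.PosSemidef) : 0 ≤ (V * U).trace := by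
  obtain ⟨N, rfl⟩ := hU.exists_transpose_mul_self
  have h := (hV.mul_mul_conjTranspose_same N).trace_nonneg
  rwa [Matrix.conjTranspose_eq_transpose_of_trivial, Matrix.mul_assoc, Matrix.trace_mul_comm,
    Matrix.mul_assoc] at h

/-- Positive semidefinite matrices that are orthogonal for the trace form have product zero. -/
theorem Matrix.PosSemidef.mul_eq_zero_of_trace {m : Type*} [Fintype m] [DecidableEq m]
    {U V : Matrix m m ℝ} (hU : U.PosSemidef) (hV : V.PosSemidef) (h : (V * U).trace = 0) :
    V * U = 0 := by
  obtain ⟨N, rfl⟩ := hU.exists_transpose_mul_self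
  obtain ⟨M, rfl⟩ := hV.exists_transpose_mul_self
  have h1 : M * Nᵀ = 0 := by
    rw [← Matrix.trace_conjTranspose_mul_self_eq_zero_iff,
      Matrix.conjTranspose_eq_transpose_of_trivial, ← h, Matrix.transpose_mul,
      Matrix.transpose_transpose, Matrix.mul_assoc, Matrix.trace_mul_comm]
    simp only [Matrix.mul_assoc]
  calc Mᵀ * M * (Nᵀ * N) = Mᵀ * (M * Nᵀ) * N := by simp only [Matrix.mul_assoc]
    _ = 0 := by rw [h1]; simp

/-- For positive semidefinite `U, V` with `⟨U, V⟩ = 0` one has `V U = 0`, so the terms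
`K X + X Kᵀ` contribute nothing and the terms `C_i X C_iᵀ` contribute something nonnegative. -/
theorem isCompletelyCrossPositive_lindbladMap {n : ℕ} {ι : Type*} [Fintype ι]
    (C : ι → Matrix (Fin n) (Fin n) ℝ) (K : Matrix (Fin n) (Fin n) ℝ) :
    IsCompletelyCrossPositive (lindbladMap C K) := by
  refine ⟨fun U => ?_, fun k U V hU hV h => ?_⟩
  · simp [lindbladMap_apply, Matrix.transpose_sum, Matrix.mul_assoc, add_comm]
  · have hVt : Vᵀ = V := by
      simpa [Matrix.conjTranspose_eq_transpose_of_trivial] using hV.1.eq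
    have hUt : Uᵀ = U := by
      simpa [Matrix.conjTranspose_eq_transpose_of_trivial] using hU.1.eq
    rw [hVt] at h ⊢
    have hVU := hU.mul_eq_zero_of_trace hV h
    have hUV : U * V = 0 := by
      rw [← hUt, ← hVt, ← Matrix.transpose_mul, hVU, Matrix.transpose_zero]
    rw [ampliation_lindbladMap, Matrix.mul_add, Matrix.mul_add, ← Matrix.mul_assoc V U, hVU,
      Matrix.trace_add, Matrix.trace_add, ← Matrix.mul_assoc, Matrix.trace_mul_cycle V, hUV,
      Matrix.mul_sum, Matrix.trace_sum]
    simp only [Matrix.zero_mul, Matrix.trace_zero, add_zero]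
    refine Finset.sum_nonneg fun i _ => Matrix.PosSemidef.trace_mul_nonneg ?_ hV
    simpa [Matrix.conjTranspose_eq_transpose_of_trivial] using
      hU.mul_mul_conjTranspose_same (1 ⊗ₖ C i)

/-! ### From complete cross-positivity to sums of squares -/

/-- The Choi matrix `(Φ(E_ij))_ij` of `Φ`. -/
noncomputable def choi {n : ℕ} (Φ : Matrix (Fin n) (Fin n) ℝ →ₗ[ℝ] Matrix (Fin n) (Fin n) ℝ) :
    Matrix (Fin n × Fin n) (Fin n × Fin n) ℝ :=
  Matrix.of fun a b => Φ (Matrix.single a.1 b.1 1) a.2 b.2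

/-- The identity matrix, regarded as a vector. -/
noncomputable def vecOne (n : ℕ) : Fin n × Fin n → ℝ := fun a => if a.1 = a.2 then 1 else 0

theorem ampliation_vecOne {n : ℕ}
    (Φ : Matrix (Fin n) (Fin n) ℝ →ₗ[ℝ] Matrix (Fin n) (Fin n) ℝ) :
    ampliation n Φ (Matrix.vecMulVec (vecOne n) (vecOne n)) = choi Φ := by
  ext a b
  change Φ _ a.2 b.2 = Φ _ a.2 b.2
  refine congrFun (congrFun (congrArg Φ ?_) _) _
  ext i j
  simp only [Matrix.vecMulVec_apply, vecOne, Matrix.of_apply, Matrix.single_apply]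
  by_cases h1 : a.1 = i <;> by_cases h2 : b.1 = j <;> simp [h1, h2]

theorem trace_vecMulVec_transpose_mul {m : Type*} [Fintype m] (v : m → ℝ) (M : Matrix m m ℝ) :
    ((Matrix.vecMulVec v v)ᵀ * M).trace = v ⬝ᵥ M *ᵥ v := by
  rw [Matrix.transpose_vecMulVec, Matrix.vecMulVec_mul, Matrix.trace_vecMulVec,
    Matrix.dotProduct_mulVec, dotProduct_comm]

/-- The Choi matrix of a completely cross-positive map is nonnegative on the orthogonal complement
of the identity, that is, on traceless matrices. -/
theorem IsCompletelyCrossPositive.choi_nonneg {n : ℕ}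
    {Φ : Matrix (Fin n) (Fin n) ℝ →ₗ[ℝ] Matrix (Fin n) (Fin n) ℝ}
    (h : IsCompletelyCrossPositive Φ) (v : Fin n × Fin n → ℝ) (hv : vecOne n ⬝ᵥ v = 0) :
    0 ≤ v ⬝ᵥ choi Φ *ᵥ v := by
  have h1 := h.2 n (Matrix.vecMulVec (vecOne n) (vecOne n)) (Matrix.vecMulVec v v)
    (by simpa using Matrix.posSemidef_vecMulVec_self_star (vecOne n))
    (by simpa using Matrix.posSemidef_vecMulVec_self_star v)
  rw [ampliation_vecOne, trace_vecMulVec_transpose_mul, trace_vecMulVec_transpose_mul] at h1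
  refine h1 ?_
  rw [Matrix.vecMulVec_mulVec, hv]
  simp

/-- A symmetric matrix that is nonnegative on `w^⊥` agrees, on all vectors orthogonal to `w` over
an arbitrary `ℝ`-algebra, with the Gram matrix of a family of vectors. -/
theorem exists_gram_of_nonneg_on_orthogonal {m : Type*} [Fintype m] [DecidableEq m]
    (M : Matrix m m ℝ) (hM : Mᵀ = M) (w : m → ℝ) (hw : w ⬝ᵥ w ≠ 0)
    (h : ∀ v, w ⬝ᵥ v = 0 → 0 ≤ v ⬝ᵥ M *ᵥ v) :
    ∃ N : Matrix m m ℝ, ∀ (R : Type) [CommRing R] [Algebra ℝ R] (z : m → R),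
      (algebraMap ℝ R ∘ w) ⬝ᵥ z = 0 →
      z ⬝ᵥ (M.map (algebraMap ℝ R)) *ᵥ z =
        ∑ r, ((N.map (algebraMap ℝ R)) *ᵥ z) r * ((N.map (algebraMap ℝ R)) *ᵥ z) r := by
  -- `P` is the orthogonal projection onto `w^⊥`.
  let P : Matrix m m ℝ := 1 - (w ⬝ᵥ w)⁻¹ • Matrix.vecMulVec w w
  have hPt : Pᵀ = P := by simp [P, Matrix.transpose_vecMulVec]
  have hPw : ∀ v, w ⬝ᵥ P *ᵥ v = 0 := by
    intro v
    simp only [P, Matrix.sub_mulVec, Matrix.one_mulVec, Matrix.smul_mulVec,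
      Matrix.vecMulVec_mulVec, dotProduct_sub, dotProduct_smul, op_smul_eq_smul,
      smul_eq_mul]
    field_simp
    ring
  have hpsd : (Pᵀ * M * P).PosSemidef := by
    refine .of_dotProduct_mulVec_nonneg ?_ fun v => ?_
    · rw [Matrix.IsHermitian, Matrix.conjTranspose_eq_transpose_of_trivial]
      simp [hM, Matrix.mul_assoc]
    · have := h _ (hPw v)
      rwa [star_trivial, ← Matrix.mulVec_mulVec, ← Matrix.mulVec_mulVec,
        Matrix.dotProduct_mulVec, Matrix.vecMul_transpose]
  obtain ⟨N, hN⟩ := hpsd.exists_transpose_mul_self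
  refine ⟨N, fun R _ _ z hz => ?_⟩
  have hPz : (P.map (algebraMap ℝ R)) *ᵥ z = z := by
    have : P.map (algebraMap ℝ R) = 1 - (w ⬝ᵥ w)⁻¹ •
        Matrix.vecMulVec (algebraMap ℝ R ∘ w) (algebraMap ℝ R ∘ w) := by
      ext i j
      simp [P, Matrix.vecMulVec_apply, Matrix.one_apply, apply_ite (algebraMap ℝ R),
        Algebra.smul_def (A := R)]
    rw [this, Matrix.sub_mulVec, Matrix.one_mulVec, Matrix.smul_mulVec, Matrix.vecMulVec_mulVec,
      hz]
    simp
  have hmap := congrArg (fun B => B.map (algebraMap ℝ R)) hN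
  simp only [Matrix.map_mul, Matrix.transpose_map] at hmap
  calc z ⬝ᵥ (M.map (algebraMap ℝ R)) *ᵥ z
      = z ⬝ᵥ ((P.map (algebraMap ℝ R))ᵀ * M.map (algebraMap ℝ R) *
          P.map (algebraMap ℝ R)) *ᵥ z := by
        rw [← Matrix.mulVec_mulVec, ← Matrix.mulVec_mulVec, Matrix.dotProduct_mulVec z (_ᵀ),
          Matrix.vecMul_transpose, hPz]
    _ = _ := by
        rw [hmap, ← Matrix.mulVec_mulVec, Matrix.dotProduct_mulVec z, Matrix.vecMul_transpose]
        rfl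

/-- `p_A = ∑ Φ(E_ij)_{kl} (x_i y_k)(x_j y_l)` for every extension `Φ` of `A`. -/
theorem pForm_eq_choi {n : ℕ} {A : symMat n →ₗ[ℝ] symMat n}
    {Φ : Matrix (Fin n) (Fin n) ℝ →ₗ[ℝ] Matrix (Fin n) (Fin n) ℝ}
    (hA : ∀ S : symMat n, Φ S.1 = (A S).1) :
    pForm A = (fun a : Fin n × Fin n => X (Sum.inl a.1) * X (Sum.inr a.2)) ⬝ᵥ
      ((choi Φ).map C) *ᵥ (fun a : Fin n × Fin n =>
        (X (Sum.inl a.1) * X (Sum.inr a.2) : MvPolynomial (Fin n ⊕ Fin n) ℝ)) := by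
  refine MvPolynomial.funext fun v => ?_
  obtain ⟨x, y, rfl⟩ : ∃ x y : Fin n → ℝ, v = Sum.elim x y :=
    ⟨v ∘ Sum.inl, v ∘ Sum.inr, (Sum.elim_comp_inl_inr v).symm⟩
  have hx : (rankOne x).1 = ∑ i, ∑ j, (x i * x j) • Matrix.single i j (1 : ℝ) := by
    ext a b
    simp [rankOne, Matrix.vecMulVec_apply, Matrix.sum_apply, Matrix.single_apply, ite_and]
  rw [eval_pForm, ← hA, hx]
  simp only [map_sum, map_smul, dotProduct, Matrix.mulVec, map_mul, eval_X, Sum.elim_inl,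
    Sum.elim_inr, Matrix.map_apply, eval_C, Fintype.sum_prod_type, Matrix.sum_apply,
    Matrix.smul_apply, smul_eq_mul, choi, Matrix.of_apply, Finset.mul_sum, Finset.sum_mul]
  refine Eq.trans (Finset.sum_congr rfl fun k _ => ?_) Finset.sum_comm
  refine Eq.trans Finset.sum_comm (Finset.sum_congr rfl fun i _ => ?_)
  refine Eq.trans Finset.sum_comm ?_
  refine Finset.sum_congr rfl fun j _ => Finset.sum_congr rfl fun l _ => ?_
  ring

theorem exists_isSumSq_sub_mem_orthIdeal {n : ℕ} (hn : 2 ≤ n) {A : symMat n →ₗ[ℝ] symMat n}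
    {Φ : Matrix (Fin n) (Fin n) ℝ →ₗ[ℝ] Matrix (Fin n) (Fin n) ℝ}
    (hΦ : IsCompletelyCrossPositive Φ) (hA : ∀ S : symMat n, Φ S.1 = (A S).1) :
    ∃ s : MvPolynomial (Fin n ⊕ Fin n) ℝ, IsSumSq s ∧ pForm A - s ∈ orthIdeal n := by
  have hsym : (choi Φ)ᵀ = choi Φ := by
    ext a b
    have := congrFun (congrFun (hΦ.1 (Matrix.single a.1 b.1 1)) b.2) a.2
    simpa [choi, Matrix.transpose_single] using this
  have hw : vecOne n ⬝ᵥ vecOne n ≠ 0 := by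
    simp [vecOne, dotProduct, Fintype.sum_prod_type]
    omega
  obtain ⟨N, hN⟩ := exists_gram_of_nonneg_on_orthogonal (choi Φ) hsym _ hw hΦ.choi_nonneg
  let z : Fin n × Fin n → MvPolynomial (Fin n ⊕ Fin n) ℝ :=
    fun a => X (Sum.inl a.1) * X (Sum.inr a.2)
  refine ⟨∑ r, ((N.map C) *ᵥ z) r * ((N.map C) *ᵥ z) r, .sum_mul_self _ _, ?_⟩
  let π := Ideal.Quotient.mk (orthIdeal n)
  have hπC : ∀ c : ℝ, π (C c) = algebraMap ℝ _ c := fun c => rfl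
  have h := hN (MvPolynomial (Fin n ⊕ Fin n) ℝ ⧸ orthIdeal n) (fun a => π (z a)) (by
    have h0 : π (∑ i : Fin n, X (Sum.inl i) * X (Sum.inr i)) = 0 :=
      Ideal.Quotient.eq_zero_iff_mem.mpr (Ideal.subset_span rfl)
    rw [← h0]
    simp [dotProduct, vecOne, Fintype.sum_prod_type, z, apply_ite (algebraMap ℝ _)])
  rw [← Ideal.Quotient.eq_zero_iff_mem, map_sub, sub_eq_zero, pForm_eq_choi hA]
  change π (z ⬝ᵥ _ *ᵥ z) = π _
  simpa only [dotProduct, Matrix.mulVec, map_sum, map_mul, Matrix.map_apply, hπC] using h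

/-! ### From sums of squares modulo the ideal to sums of squares after substitution -/

theorem aeval_psi_eq_zero_of_mem_orthIdeal {m : ℕ}
    {r : MvPolynomial (Fin (m + 1) ⊕ Fin (m + 1)) ℝ} (hr : r ∈ orthIdeal (m + 1)) :
    aeval (psi (m + 1)) r = 0 := by
  suffices h : orthIdeal (m + 1) ≤ RingHom.ker (aeval (R := ℝ) (psi (m + 1))) from h hr
  rw [orthIdeal, Ideal.span_le, Set.singleton_subset_iff, SetLike.mem_coe, RingHom.mem_ker]
  simp only [map_sum, map_mul, aeval_X, psi, Sum.elim_inl, Sum.elim_inr, mul_sub,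
    Finset.sum_sub_distrib]
  rw [sub_eq_zero, Fin.sum_univ_castSucc, Fin.sum_univ_succ]
  simp
  refine Finset.sum_congr rfl fun i _ => ?_
  exact (by intros; ring : ∀ a b c : MvPolynomial (Fin (m + 1) ⊕ Fin m) ℝ,
    a * (b * c) = c * (b * a)) _ _ _

/-! ### Squares bounded by a weighted homogeneous polynomial -/

theorem IsSumSq.exists_sum_mul_self {R : Type*} [NonUnitalNonAssocSemiring R] {s : R}
    (hs : IsSumSq s) : ∃ (N : ℕ) (f : Fin N → R), s = ∑ i, f i * f i := by
  induction hs with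
  | zero => exact ⟨0, Fin.elim0, by simp⟩
  | sq_add a _ ih =>
    obtain ⟨N, f, rfl⟩ := ih
    exact ⟨N + 1, Fin.cons a f, by simp [Fin.sum_univ_succ]⟩

theorem Polynomial.natDegree_eq_zero_of_sq_le (p : Polynomial ℝ) (c : ℝ)
    (h : ∀ t, p.eval t ^ 2 ≤ c) : p.natDegree = 0 := by
  by_contra hd
  have ht := Polynomial.abs_tendsto_atTop p
    (Polynomial.natDegree_pos_iff_degree_pos.mp (Nat.pos_of_ne_zero hd))
  obtain ⟨t, ht⟩ := (ht.eventually (Filter.eventually_gt_atTop (|c| + 1))).exists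
  have h1 := h t
  rw [← sq_abs] at h1
  nlinarith [abs_nonneg c, le_abs_self c]

/-- A real polynomial `p` with `p(t)² ≤ c t^{2d}` is a multiple of `t^d`: the bound at `0` allows
one to divide by `t`, and a bounded polynomial is constant. -/
theorem Polynomial.coeff_eq_zero_of_sq_le (d : ℕ) (p : Polynomial ℝ) (c : ℝ)
    (h : ∀ t, p.eval t ^ 2 ≤ c * t ^ (2 * d)) (e : ℕ) (he : e ≠ d) : p.coeff e = 0 := by
  induction d generalizing p e with
  | zero =>
    exact Polynomial.coeff_eq_zero_of_natDegree_lt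
      (by rw [p.natDegree_eq_zero_of_sq_le c (by simpa using h)]; omega)
  | succ d ih =>
    have h0 : p.eval 0 = 0 := by
      have := h 0
      rw [mul_add, pow_add] at this
      exact pow_eq_zero_iff two_ne_zero |>.mp (le_antisymm (by simpa using this) (sq_nonneg _))
    obtain ⟨r, rfl⟩ : Polynomial.X ∣ p := by
      rwa [Polynomial.X_dvd_iff, Polynomial.coeff_zero_eq_eval_zero]
    cases e with
    | zero => simp
    | succ e =>
      rw [Polynomial.coeff_X_mul]
      refine ih r ?_ e (by omega)
      have hne : ∀ t ≠ 0, r.eval t ^ 2 ≤ c * t ^ (2 * d) := by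
        intro t ht
        have h1 := h t
        have : 0 < t ^ 2 := by positivity
        rw [Polynomial.eval_mul, Polynomial.eval_X] at h1
        refine le_of_mul_le_mul_left ?_ this
        calc t ^ 2 * r.eval t ^ 2 = (t * r.eval t) ^ 2 := by ring
          _ ≤ _ := h1
          _ = _ := by ring
      have hd : Dense {t : ℝ | t ≠ 0} := dense_compl_singleton 0
      have hcl : IsClosed {t : ℝ | r.eval t ^ 2 ≤ c * t ^ (2 * d)} :=
        isClosed_le (by fun_prop) (by fun_prop)
      exact fun t => hcl.closure_subset_iff.mpr hne (hd t)

/-- Along the dilation curve `t ↦ (v_i t^{w_i})_i` a polynomial restricts to the polynomial in `t`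
whose coefficients are the values at `v` of its weighted homogeneous components. -/
theorem MvPolynomial.coeff_aeval_weight {σ : Type*} (w : σ → ℕ) (f : MvPolynomial σ ℝ)
    (v : σ → ℝ) (e : ℕ) :
    (aeval (fun i => Polynomial.C (v i) * Polynomial.X ^ w i) f).coeff e =
      eval v (weightedHomogeneousComponent w e f) := by
  induction f using MvPolynomial.induction_on' with
  | add p q hp hq => simp [hp, hq]
  | monomial u a =>
    have hmon : aeval (fun i => Polynomial.C (v i) * Polynomial.X ^ w i) (monomial u a) =
        Polynomial.C (a * u.prod fun i k => v i ^ k) * Polynomial.X ^ Finsupp.weight w u := by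
      rw [aeval_monomial, Polynomial.C_mul, mul_assoc, Polynomial.algebraMap_eq,
        Finsupp.weight_apply]
      simp only [Finsupp.prod, Finsupp.sum, map_prod, map_pow, mul_pow, Finset.prod_mul_distrib,
        ← pow_mul, Finset.prod_pow_eq_pow_sum, smul_eq_mul, mul_comm]
    rw [hmon, Polynomial.coeff_C_mul_X_pow]
    have hw := isWeightedHomogeneous_monomial w u a (rfl : Finsupp.weight w u = _)
    split_ifs with h
    · rw [h, hw.weightedHomogeneousComponent_same, eval_monomial]
    · rw [hw.weightedHomogeneousComponent_ne e h, map_zero]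

/-- A polynomial whose square grows at most like `t^{2d}` along all weighted dilations is weighted
homogeneous of degree `d`. -/
theorem MvPolynomial.isWeightedHomogeneous_of_sq_le {σ : Type*} (w : σ → ℕ) (d : ℕ)
    (f : MvPolynomial σ ℝ)
    (h : ∀ v : σ → ℝ, ∃ c, ∀ t : ℝ, eval (fun i => v i * t ^ w i) f ^ 2 ≤ c * t ^ (2 * d)) :
    IsWeightedHomogeneous w f d := by
  intro u hu
  by_contra hne
  refine hu ?_
  have h0 : weightedHomogeneousComponent w (Finsupp.weight w u) f = 0 := by
    refine MvPolynomial.funext fun v => ?_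
    obtain ⟨c, hc⟩ := h v
    rw [← coeff_aeval_weight, map_zero]
    refine Polynomial.coeff_eq_zero_of_sq_le d _ c (fun t => ?_) _ hne
    convert hc t using 2
    rw [← Polynomial.coe_aeval_eq_eval, comp_aeval_apply, aeval_eq_eval]
    simp
  classical
  have := congrArg (coeff u) h0
  rwa [coeff_weightedHomogeneousComponent, if_pos rfl, coeff_zero] at this

theorem Finsupp.exists_eq_single_add_of_weight {σ : Type*} (w : σ → ℕ) (hw : ∀ i, w i ≤ 1)
    (u : σ →₀ ℕ) (d : ℕ) (hu : Finsupp.weight w u = d + 1) :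
    ∃ i u', w i = 1 ∧ u = Finsupp.single i 1 + u' ∧ Finsupp.weight w u' = d := by
  obtain ⟨i, hi, hne⟩ : ∃ i ∈ u.support, u i * w i ≠ 0 := by
    by_contra! hc
    rw [Finsupp.weight_apply, Finsupp.sum, Finset.sum_eq_zero (by simpa using hc)] at hu
    omega
  have hwi : w i = 1 := by
    have := hw i
    have : w i ≠ 0 := right_ne_zero_of_mul hne
    omega
  have hle : Finsupp.single i 1 ≤ u := by
    rw [Finsupp.single_le_iff]
    exact Nat.one_le_iff_ne_zero.mpr (left_ne_zero_of_mul hne)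
  refine ⟨i, u - Finsupp.single i 1, hwi, (add_tsub_cancel_of_le hle).symm, ?_⟩
  have := congrArg (Finsupp.weight w) (add_tsub_cancel_of_le hle)
  rw [map_add, Finsupp.weight_single, hu, hwi] at this
  simp at this
  omega

/-- A polynomial that is quadratic in the first group of variables and linear in the second one is
a combination of the second variables with quadratic forms as coefficients. -/
theorem MvPolynomial.exists_quadraticForm_of_isWeightedHomogeneous {σ τ : Type*} [Fintype σ]
    [Fintype τ] [DecidableEq τ] (f : MvPolynomial (σ ⊕ τ) ℝ)
    (h₁ : IsWeightedHomogeneous (Sum.elim (fun _ => 1) fun _ => 0 : σ ⊕ τ → ℕ) f 2)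
    (h₂ : IsWeightedHomogeneous (Sum.elim (fun _ => 0) fun _ => 1 : σ ⊕ τ → ℕ) f 1) :
    ∃ g : τ → QuadraticForm ℝ (σ → ℝ), ∀ x α, eval (Sum.elim x α) f = ∑ k, α k * g k x := by
  set w₁ : σ ⊕ τ → ℕ := Sum.elim (fun _ => 1) fun _ => 0
  set w₂ : σ ⊕ τ → ℕ := Sum.elim (fun _ => 0) fun _ => 1
  have hle₁ : ∀ i, w₁ i ≤ 1 := by rintro (i | i) <;> simp [w₁]
  have hle₂ : ∀ i, w₂ i ≤ 1 := by rintro (i | i) <;> simp [w₂]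
  have key : ∃ g : τ → QuadraticForm ℝ (σ → ℝ), ∀ x α,
      eval (Sum.elim x α) (∑ u ∈ f.support, monomial u (coeff u f)) = ∑ k, α k * g k x := by
    refine Finset.sum_induction _ (fun p => ∃ g : τ → QuadraticForm ℝ (σ → ℝ), ∀ x α,
      eval (Sum.elim x α) p = ∑ k, α k * g k x) ?_ ⟨0, by simp⟩ ?_
    · rintro p q ⟨g, hg⟩ ⟨g', hg'⟩
      refine ⟨g + g', fun x α => ?_⟩
      simp [hg, hg', mul_add, Finset.sum_add_distrib]
    · intro u hu
      have hu1 := h₁ (mem_support_iff.mp hu)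
      have hu2 := h₂ (mem_support_iff.mp hu)
      generalize coeff u f = c
      clear hu
      obtain ⟨k, u₁, hk, rfl, hu₁⟩ :=
        Finsupp.exists_eq_single_add_of_weight w₂ hle₂ u 0 hu2
      rcases k with k | k
      · simp [w₂] at hk
      rw [map_add, Finsupp.weight_single] at hu1
      obtain ⟨a, u₂, ha, rfl, hu₂⟩ :=
        Finsupp.exists_eq_single_add_of_weight w₁ hle₁ u₁ 1 (by simpa [w₁] using hu1)
      rcases a with a | a
      swap
      · simp [w₁] at ha
      obtain ⟨b, u₃, hb, rfl, hu₃⟩ :=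
        Finsupp.exists_eq_single_add_of_weight w₁ hle₁ u₂ 0 hu₂
      rcases b with b | b
      swap
      · simp [w₁] at hb
      have h0 : u₃ = 0 := by
        have h0' : Finsupp.weight w₂ u₃ = 0 := by
          simpa [Finsupp.weight_single, w₂] using hu₁
        ext i
        refine Nat.le_zero.mp ?_
        rcases i with i | i
        · exact (Finsupp.le_weight w₁ (by simp [w₁]) u₃).trans hu₃.le
        · exact (Finsupp.le_weight w₂ (by simp [w₂]) u₃).trans h0'.le
      subst h0
      refine ⟨Pi.single k (c • QuadraticMap.proj a b), fun x α => ?_⟩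
      rw [Finset.sum_eq_single k (by intro j _ hj; simp [Pi.single_eq_of_ne hj]) (by simp),
        Pi.single_eq_same]
      simp only [← add_assoc, add_zero, eval_monomial]
      rw [Finsupp.prod_add_index' (by simp) (by intros; ring),
        Finsupp.prod_add_index' (by simp) (by intros; ring)]
      simp
      ring
  rwa [f.support_sum_monomial_coeff] at key

/-! ### Quadratic forms and generic points -/

theorem eventually_add_mul_ne_zero {a u : ℝ} (hu : u ≠ 0) :
    ∀ᶠ t in nhdsWithin (0 : ℝ) {0}ᶜ, a + t * u ≠ 0 := by
  have h : ∀ c : ℝ, ∀ᶠ t in nhdsWithin (0 : ℝ) {0}ᶜ, t ≠ c := by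
    intro c
    by_cases hc : c = 0
    · subst hc
      exact self_mem_nhdsWithin
    · exact nhdsWithin_le_nhds (eventually_ne_nhds (Ne.symm hc))
  filter_upwards [h (-a / u)] with t ht hz
  refine ht ?_
  field_simp
  linarith

theorem eq_zero_of_eventually_eq_zero {n : ℕ} {f : (Fin n → ℝ) → ℝ} (hf : Continuous f)
    (x u : Fin n → ℝ) (h : ∀ᶠ t in nhdsWithin (0 : ℝ) {0}ᶜ, f (x + t • u) = 0) : f x = 0 := by
  have h1 : Filter.Tendsto (fun t : ℝ => f (x + t • u)) (nhdsWithin 0 {0}ᶜ) (nhds (f x)) := by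
    have : Continuous fun t : ℝ => f (x + t • u) := by fun_prop
    simpa using (this.tendsto 0).mono_left nhdsWithin_le_nhds
  exact tendsto_nhds_unique h1 (tendsto_const_nhds.congr' (h.mono fun _ ht => ht.symm))

/-- A continuous function vanishing wherever all coordinates are nonzero vanishes. -/
theorem eq_zero_of_forall_ne_zero {n : ℕ} {f : (Fin n → ℝ) → ℝ} (hf : Continuous f)
    (h : ∀ x, (∀ i, x i ≠ 0) → f x = 0) (x : Fin n → ℝ) : f x = 0 := by
  refine eq_zero_of_eventually_eq_zero hf x 1 ?_
  have : ∀ᶠ t in nhdsWithin (0 : ℝ) {0}ᶜ, ∀ i, x i + t * 1 ≠ 0 :=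
    Filter.eventually_all.mpr fun i => eventually_add_mul_ne_zero one_ne_zero
  filter_upwards [this] with t ht using h _ fun i => by simpa using ht i

theorem eq_zero_on_hyperplane {n : ℕ} {f : (Fin n → ℝ) → ℝ} (hf : Continuous f) {j l : Fin n}
    (hjl : j ≠ l) (h : ∀ x, x j = 0 → x l ≠ 0 → f x = 0) (x : Fin n → ℝ) (hx : x j = 0) :
    f x = 0 := by
  refine eq_zero_of_eventually_eq_zero hf x (Pi.single l 1) ?_
  filter_upwards [eventually_add_mul_ne_zero (a := x l) one_ne_zero] with t ht
  exact h _ (by simp [hx, hjl]) (by simpa using ht)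

theorem QuadraticMap.continuous_pi {n : ℕ} (Q : QuadraticForm ℝ (Fin n → ℝ)) : Continuous Q := by
  have h : ∀ x, Q x = QuadraticMap.associated (R := ℝ) Q x x := fun x =>
    (QuadraticMap.associated_eq_self_apply ℝ Q x).symm
  have h' : (Q : (Fin n → ℝ) → ℝ) = fun x =>
      LinearMap.toContinuousLinearMap
        (LinearMap.toContinuousLinearMap.toLinearMap ∘ₗ QuadraticMap.associated (R := ℝ) Q) x x :=
    _root_.funext h
  rw [h']
  fun_prop

/-- A quadratic form vanishing on the hyperplane `x_j = 0` is `x_j` times a linear form. -/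
theorem QuadraticMap.exists_eq_mul_of_vanishing {n : ℕ} (Q : QuadraticForm ℝ (Fin n → ℝ))
    (j : Fin n) (h : ∀ x, x j = 0 → Q x = 0) :
    ∃ ℓ : (Fin n → ℝ) →ₗ[ℝ] ℝ, ∀ x, Q x = x j * ℓ x := by
  let e : Fin n → ℝ := Pi.single j 1
  refine ⟨QuadraticMap.polarBilin Q e - Q e • LinearMap.proj j, fun x => ?_⟩
  have h1 : Q (x + (-x j) • e) = 0 := h _ (by simp [e])
  rw [QuadraticMap.map_add Q, QuadraticMap.polar_smul_right, QuadraticMap.map_smul,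
    QuadraticMap.polar_comm] at h1
  simp only [LinearMap.sub_apply, QuadraticMap.polarBilin_apply_apply, LinearMap.smul_apply,
    LinearMap.proj_apply, smul_eq_mul] at h1 ⊢
  linarith

/-! ### The parametrization of the orthogonal complement -/

/-- The vector `x_l e_j - x_j e_l`, which is orthogonal to `x`. -/
noncomputable def orthVec {n : ℕ} (x : Fin n → ℝ) (j l : Fin n) : Fin n → ℝ :=
  Pi.single j (x l) - Pi.single l (x j)

/-- The vector `y(x, α) = ∑ k, α_k (x_{k+1} e_k - x_k e_{k+1})` of the substitution `Ψ`. -/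
noncomputable def psiVec {m : ℕ} (x : Fin (m + 1) → ℝ) (α : Fin m → ℝ) : Fin (m + 1) → ℝ :=
  ∑ k, α k • orthVec x k.castSucc k.succ

theorem psiVec_dotProduct {m : ℕ} (x : Fin (m + 1) → ℝ) (α : Fin m → ℝ) (z : Fin (m + 1) → ℝ) :
    psiVec x α ⬝ᵥ z = ∑ k, α k * (x k.succ * z k.castSucc - x k.castSucc * z k.succ) := by
  simp [psiVec, orthVec, sum_dotProduct, sub_dotProduct]

theorem psiVec_single {m : ℕ} (x : Fin (m + 1) → ℝ) (k : Fin m) (c : ℝ) :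
    psiVec x (Pi.single k c) = c • orthVec x k.castSucc k.succ := by
  simp [psiVec, Pi.single_apply, ite_smul]

theorem psiVec_add {m : ℕ} (x : Fin (m + 1) → ℝ) (α β : Fin m → ℝ) :
    psiVec x (α + β) = psiVec x α + psiVec x β := by
  simp [psiVec, add_smul, Finset.sum_add_distrib]

theorem psiVec_smul {m : ℕ} (x : Fin (m + 1) → ℝ) (α : Fin m → ℝ) (c : ℝ) :
    psiVec x (c • α) = c • psiVec x α := by
  simp [psiVec, mul_smul, Finset.smul_sum]

theorem psiVec_smul_left {m : ℕ} (x : Fin (m + 1) → ℝ) (α : Fin m → ℝ) (c : ℝ) :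
    psiVec (c • x) α = c • psiVec x α := by
  simp only [psiVec, Finset.smul_sum, orthVec, Pi.smul_apply, Pi.single_smul', ← smul_sub]
  exact Finset.sum_congr rfl fun k _ => smul_comm _ _ _

theorem eval_psi_inr {m : ℕ} (x : Fin (m + 1) → ℝ) (α : Fin m → ℝ) (i : Fin (m + 1)) :
    eval (Sum.elim x α : Fin (m + 1) ⊕ Fin (m + 1 - 1) → ℝ) (psi (m + 1) (Sum.inr i)) =
      psiVec x α i := by
  have h : psiVec x α i = (∑ k : Fin m, if i = k.castSucc then α k * x k.succ else 0) -
      ∑ k : Fin m, if i = k.succ then α k * x k.castSucc else 0 := by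
    simp [psiVec, orthVec, Finset.sum_apply, Pi.single_apply, mul_sub]
  rw [h]
  simp only [psi, Sum.elim_inr, map_sub]
  congr 1
  · induction i using Fin.lastCases with
    | last =>
      rw [dif_neg (by simp), map_zero, eq_comm]
      exact Finset.sum_eq_zero fun k _ => if_neg (Fin.castSucc_ne_last k).symm
    | cast i =>
      have hi : ∀ hlt, (⟨(i : ℕ) + 1, hlt⟩ : Fin (m + 1)) = i.succ := fun _ => rfl
      simp [hi]
  · induction i using Fin.cases with
    | zero =>
      rw [dif_neg (by simp), map_zero, eq_comm]
      exact Finset.sum_eq_zero fun k _ => if_neg (Fin.succ_ne_zero k).symm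
    | succ i =>
      have hi : ∀ hlt, (⟨(i : ℕ), hlt⟩ : Fin (m + 1)) = i.castSucc := fun _ => rfl
      simp [hi]

theorem eval_qForm {m : ℕ} (A : symMat (m + 1) →ₗ[ℝ] symMat (m + 1)) (x : Fin (m + 1) → ℝ)
    (α : Fin m → ℝ) :
    eval (Sum.elim x α : Fin (m + 1) ⊕ Fin (m + 1 - 1) → ℝ) (qForm A) =
      psiVec x α ⬝ᵥ (A (rankOne x)).1 *ᵥ psiVec x α := by
  rw [← eval_pForm, qForm, ← aeval_eq_eval, comp_aeval_apply, aeval_eq_eval]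
  refine congrArg (fun v => eval v (pForm A)) (_root_.funext fun i => ?_)
  rcases i with i | i
  · simp [psi]
  · exact eval_psi_inr x α i

/-- If all coordinates of `x` are nonzero, the consecutive vectors `x_{k+1} e_k - x_k e_{k+1}` span
all the vectors `x_l e_j - x_j e_l`, because
`x_k (x_l e_j - x_j e_l) = x_l (x_k e_j - x_j e_k) + x_j (x_l e_k - x_k e_l)`. -/
theorem exists_psiVec_eq_orthVec {m : ℕ} (x : Fin (m + 1) → ℝ) (hx : ∀ i, x i ≠ 0)
    (j l : Fin (m + 1)) : ∃ α, psiVec x α = orthVec x j l := by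
  have trans : ∀ j k l, (∃ α, psiVec x α = orthVec x j k) → (∃ α, psiVec x α = orthVec x k l) →
      ∃ α, psiVec x α = orthVec x j l := by
    rintro j k l ⟨α, hα⟩ ⟨β, hβ⟩
    refine ⟨(x k)⁻¹ • (x l • α + x j • β), ?_⟩
    rw [psiVec_smul, psiVec_add, psiVec_smul, psiVec_smul, hα, hβ, inv_smul_eq_iff₀ (hx k)]
    ext i
    simp only [orthVec, Pi.add_apply, Pi.smul_apply, Pi.sub_apply, Pi.single_apply, smul_eq_mul]
    split_ifs <;> ring
  have symm : ∀ j l, (∃ α, psiVec x α = orthVec x j l) → ∃ α, psiVec x α = orthVec x l j := by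
    rintro j l ⟨α, hα⟩
    exact ⟨(-1 : ℝ) • α, by rw [psiVec_smul, hα]; simp [orthVec]⟩
  have zero : ∀ l, ∃ α, psiVec x α = orthVec x 0 l := by
    intro l
    induction l using Fin.induction with
    | zero => exact ⟨0, by simp [psiVec, orthVec]⟩
    | succ k ih => exact trans _ _ _ ih ⟨Pi.single k 1, by simp [psiVec_single]⟩
  exact trans _ _ _ (symm _ _ (zero j)) (zero l)

/-! ### Lifting the squares to bilinear forms -/

theorem Fin.exists_chain {m : ℕ} {β : Type*} (P : Fin (m + 1) → β → Prop)
    (R : Fin m → β → β → Prop) (h0 : ∃ b, P 0 b)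
    (hs : ∀ k b, P k.castSucc b → ∃ b', P k.succ b' ∧ R k b b') :
    ∃ L : Fin (m + 1) → β, ∀ k, R k (L k.castSucc) (L k.succ) := by
  obtain ⟨b, hb⟩ := h0
  choose next hP hR using hs
  let F : ∀ j : Fin (m + 1), {b // P j b} := fun j =>
    Fin.induction (motive := fun j => {b // P j b}) ⟨b, hb⟩
      (fun k b => ⟨next k b.1 b.2, hP k b.1 b.2⟩) j
  exact ⟨fun j => (F j).1, fun k => hR k (F k.castSucc).1 (F k.castSucc).2⟩

/-- If `∑ α_k g_k(x)`, with quadratic forms `g_k`, vanishes wherever `y(x, α)` does, then it is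
`∑ y_j(x, α) L_j(x)` for linear forms `L_j`. The `L_j` are found one after the other: the degenerate
points with `x_{k+1} = 0` show that `g_{k+1} - x_{k+2} L_{k+1}` vanishes on `x_{k+1} = 0`. -/
theorem exists_linear_of_vanishing {m : ℕ} (g : Fin m → QuadraticForm ℝ (Fin (m + 1) → ℝ))
    (h : ∀ x α, psiVec x α = 0 → ∑ k, α k * g k x = 0) :
    ∃ L : Fin (m + 1) → (Fin (m + 1) → ℝ) →ₗ[ℝ] ℝ,
      ∀ k x, g k x = x k.succ * L k.castSucc x - x k.castSucc * L k.succ x := by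
  refine Fin.exists_chain
    (fun j (ℓ : (Fin (m + 1) → ℝ) →ₗ[ℝ] ℝ) => ∀ k : Fin m, k.castSucc = j →
      ∀ x : Fin (m + 1) → ℝ, x j = 0 → g k x = x k.succ * ℓ x)
    (fun k (ℓ ℓ' : (Fin (m + 1) → ℝ) →ₗ[ℝ] ℝ) => ∀ x,
      g k x = x k.succ * ℓ x - x k.castSucc * ℓ' x) ?_ ?_
  · cases m with
    | zero => exact ⟨0, fun k => k.elim0⟩
    | succ m =>
      -- `T` is the coordinate projection onto the hyperplane `x_0 = 0`.
      let T : (Fin (m + 1 + 1) → ℝ) →ₗ[ℝ] (Fin (m + 1 + 1) → ℝ) :=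
        LinearMap.id - (LinearMap.single ℝ (fun _ => ℝ) 0) ∘ₗ LinearMap.proj 0
      have hT0 : ∀ x, T x 0 = 0 := by simp [T]
      have hT1 : ∀ x (k : Fin (m + 1)), T x k.succ = x k.succ := by simp [T]
      obtain ⟨ℓ, hℓ⟩ := ((g 0).comp T).exists_eq_mul_of_vanishing 1 fun x hx => by
        have h1 := h (T x) (Pi.single 0 1) (by
          have := hT1 x 0
          simp only [Fin.succ_zero_eq_one] at this
          rw [psiVec_single]
          simp [orthVec, hT0, this, hx])
        simpa [Pi.single_apply] using h1
      refine ⟨ℓ, fun k hk x hx => ?_⟩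
      obtain rfl : k = 0 := Fin.castSucc_injective _ (hk.trans Fin.castSucc_zero.symm)
      have hTx : T x = x := by simp [T, hx]
      have := hℓ x
      rwa [QuadraticMap.comp_apply, hTx] at this
  · intro k ℓ hℓ
    obtain ⟨ℓ', hℓ'⟩ := QuadraticMap.exists_eq_mul_of_vanishing
      (g k - QuadraticMap.linMulLin (LinearMap.proj k.succ) ℓ) k.castSucc fun x hx => by
        simp [hℓ k rfl x hx]
    simp only [sub_apply, QuadraticMap.linMulLin_apply, LinearMap.proj_apply] at hℓ'
    refine ⟨-ℓ', fun k' hk' x hx => ?_, fun x => ?_⟩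
    · have hne : k.succ ≠ k.castSucc := by simp [Fin.ext_iff]
      rw [← sub_eq_zero]
      refine eq_zero_on_hyperplane (f := fun x => g k' x - x k'.succ * (-ℓ') x)
        (((g k').continuous_pi).sub ((continuous_apply _).mul
          (LinearMap.continuous_of_finiteDimensional _))) hne ?_ x hx
      intro x hx hx'
      have h1 := h x (Pi.single k (x k'.succ) + Pi.single k' (x k.castSucc)) (by
        rw [psiVec_add, psiVec_single, psiVec_single, hk']
        ext i
        simp only [orthVec, Pi.add_apply, Pi.smul_apply, Pi.sub_apply, Pi.single_apply,
          smul_eq_mul, hx, Pi.zero_apply]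
        split_ifs <;> ring)
      simp only [Pi.add_apply, add_mul, Finset.sum_add_distrib, Pi.single_apply, ite_mul,
        zero_mul, Finset.sum_ite_eq', Finset.mem_univ, if_true] at h1
      have h2 := hℓ' x
      rw [hx, zero_mul, sub_zero] at h2
      rw [h2] at h1
      refine mul_left_cancel₀ hx' ?_
      simp only [LinearMap.neg_apply]
      linarith
    · have := hℓ' x
      simp only [LinearMap.neg_apply]
      linarith

/-- A polynomial `f(x, α)` with `f² ≤ q_A` is a bilinear form in `x` and `y(x, α)`: the bound
determines its bidegree and makes it vanish wherever `y(x, α)` does. -/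
theorem exists_matrix_of_sq_le {m : ℕ} (A : symMat (m + 1) →ₗ[ℝ] symMat (m + 1))
    (f : MvPolynomial (Fin (m + 1) ⊕ Fin m) ℝ)
    (hf : ∀ x α, eval (Sum.elim x α) f ^ 2 ≤
      psiVec x α ⬝ᵥ (A (rankOne x)).1 *ᵥ psiVec x α) :
    ∃ B : Matrix (Fin (m + 1)) (Fin (m + 1)) ℝ,
      ∀ x α, eval (Sum.elim x α) f = psiVec x α ⬝ᵥ B *ᵥ x := by
  obtain ⟨g, hg⟩ := f.exists_quadraticForm_of_isWeightedHomogeneous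
    (isWeightedHomogeneous_of_sq_le _ 2 f fun v => by
      refine ⟨psiVec (v ∘ Sum.inl) (v ∘ Sum.inr) ⬝ᵥ (A (rankOne (v ∘ Sum.inl))).1 *ᵥ
        psiVec (v ∘ Sum.inl) (v ∘ Sum.inr), fun t => ?_⟩
      have hr : rankOne (t • (v ∘ Sum.inl)) = t ^ 2 • rankOne (v ∘ Sum.inl) := by
        ext i j
        simp [rankOne, Matrix.vecMulVec_apply]
        ring
      have h1 := hf (t • (v ∘ Sum.inl)) (v ∘ Sum.inr)
      rw [psiVec_smul_left, hr] at h1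
      convert h1 using 1
      · refine congrArg (fun w => eval w f ^ 2) (_root_.funext fun i => ?_)
        rcases i with i | i <;> simp [mul_comm]
      · simp [Matrix.mulVec_smul, Matrix.smul_mulVec]
        ring)
    (isWeightedHomogeneous_of_sq_le _ 1 f fun v => by
      refine ⟨psiVec (v ∘ Sum.inl) (v ∘ Sum.inr) ⬝ᵥ (A (rankOne (v ∘ Sum.inl))).1 *ᵥ
        psiVec (v ∘ Sum.inl) (v ∘ Sum.inr), fun t => ?_⟩
      have h1 := hf (v ∘ Sum.inl) (t • (v ∘ Sum.inr))
      rw [psiVec_smul] at h1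
      convert h1 using 1
      · refine congrArg (fun w => eval w f ^ 2) (_root_.funext fun i => ?_)
        rcases i with i | i <;> simp [mul_comm]
      · simp [Matrix.mulVec_smul]
        ring)
  obtain ⟨L, hL⟩ := exists_linear_of_vanishing g fun x α h0 => by
    have h1 := hf x α
    rw [h0, zero_dotProduct] at h1
    rw [← hg]
    exact pow_eq_zero_iff two_ne_zero |>.mp (le_antisymm h1 (sq_nonneg _))
  refine ⟨LinearMap.toMatrix' (LinearMap.pi L), fun x α => ?_⟩
  rw [LinearMap.toMatrix'_mulVec, hg, psiVec_dotProduct]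
  exact Finset.sum_congr rfl fun k _ => by rw [hL]; rfl

/-! ### Forms vanishing on orthogonal pairs -/

/-- A symmetric matrix `D(x)` of quadratic forms with `yᵀ D(x) y = 0` for all `y = y(x, α)` is
`v xᵀ + x vᵀ` with `v` linear in `x`: the vectors `y = x_l e_j - x_j e_l` give
`x_l² D_jj - 2 x_j x_l D_jl + x_j² D_ll = 0`, so `x_j` divides `D_jj`. -/
theorem exists_eq_symm_product {m : ℕ} (hm : m ≠ 0)
    (D : Fin (m + 1) → Fin (m + 1) → QuadraticForm ℝ (Fin (m + 1) → ℝ))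
    (hD : ∀ j l, D j l = D l j)
    (h : ∀ x α, psiVec x α ⬝ᵥ (Matrix.of fun j l => D j l x) *ᵥ psiVec x α = 0) :
    ∃ K : Matrix (Fin (m + 1)) (Fin (m + 1)) ℝ,
      ∀ x j l, D j l x = (K *ᵥ x) j * x l + x j * (K *ᵥ x) l := by
  have h1 : ∀ j l x, x l ^ 2 * D j j x - 2 * (x j * x l) * D j l x + x j ^ 2 * D l l x = 0 := by
    intro j l
    refine eq_zero_of_forall_ne_zero ?_ fun x hx => ?_
    · have := fun j l => (D j l).continuous_pi
      fun_prop
    · obtain ⟨α, hα⟩ := exists_psiVec_eq_orthVec x hx j l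
      have h2 := h x α
      rw [hα] at h2
      simp [orthVec, sub_dotProduct, Matrix.mulVec_sub, hD l j] at h2
      linarith
  have h2 : ∀ j, ∃ ℓ : (Fin (m + 1) → ℝ) →ₗ[ℝ] ℝ, ∀ x, D j j x = x j * ℓ x := by
    intro j
    refine (D j j).exists_eq_mul_of_vanishing j ?_
    have : Nontrivial (Fin (m + 1)) := Fin.nontrivial_iff_two_le.mpr (by omega)
    obtain ⟨l, hl⟩ := exists_ne j
    refine eq_zero_on_hyperplane (D j j).continuous_pi hl.symm fun x hx hx' => ?_
    have := h1 j l x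
    rw [hx] at this
    simpa [hx'] using this
  choose ℓ hℓ using h2
  -- `D_jj = x_j ℓ_j` and `D_jj = 2 x_j (K x)_j`, whence the factor `1/2`.
  refine ⟨LinearMap.toMatrix' (LinearMap.pi fun j => (2⁻¹ : ℝ) • ℓ j), fun x j l => ?_⟩
  rw [LinearMap.toMatrix'_mulVec]
  change D j l x = (2⁻¹ * ℓ j x) * x l + x j * (2⁻¹ * ℓ l x)
  rw [← sub_eq_zero]
  revert x
  refine eq_zero_of_forall_ne_zero ?_ fun x hx => ?_
  · have := fun j l => (D j l).continuous_pi
    have := fun j => LinearMap.continuous_of_finiteDimensional (ℓ j)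
    fun_prop
  · have h3 := h1 j l x
    rw [hℓ, hℓ] at h3
    have : (2 * (x j * x l)) * (D j l x - (2⁻¹ * ℓ j x * x l + x j * (2⁻¹ * ℓ l x))) = 0 := by
      linear_combination -h3
    exact (mul_eq_zero.mp this).resolve_left (by simp [hx])

/-- A linear map on `S_n` is determined by its values on the matrices `x xᵀ`. -/
theorem symMat_linearMap_ext {n : ℕ} {F : Type*} [AddCommGroup F] [Module ℝ F]
    {f g : symMat n →ₗ[ℝ] F} (h : ∀ x, f (rankOne x) = g (rankOne x)) : f = g := by
  have h1 : ∀ i j : Fin n, symUnit i j = (2⁻¹ : ℝ) •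
      (rankOne (Pi.single i 1 + Pi.single j 1) - rankOne (Pi.single i 1) -
        rankOne (Pi.single j 1)) := by
    intro i j
    apply Subtype.ext
    simp only [symUnit, rankOne, Submodule.coe_smul, Submodule.coe_sub, Matrix.add_vecMulVec,
      Matrix.vecMulVec_add, Matrix.single_eq_single_vecMulVec_single]
    congr 1
    abel
  ext S
  have hS : S = ∑ i, ∑ j, S.1 i j • symUnit i j := by
    apply Subtype.ext
    ext a b
    have hab : S.1 b a = S.1 a b := congrFun (congrFun S.2 a) b
    simp only [symUnit, AddSubmonoidClass.coe_finsetSum, Submodule.coe_smul, Matrix.sum_apply,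
      Matrix.smul_apply, Matrix.add_apply, smul_eq_mul, Matrix.single_apply, ite_and, mul_add,
      mul_ite, mul_one, mul_zero, Finset.sum_add_distrib, Finset.sum_ite_eq', Finset.mem_univ,
      if_true, Finset.sum_ite_irrel, Finset.sum_const_zero, hab]
    ring
  rw [hS]
  simp only [map_sum, map_smul, h1, map_sub, h]

/-- If `q_A = ∑ q_i²` with `q_i = yᵀ B_i x`, then `A(x xᵀ) - ∑ B_i x xᵀ B_iᵀ` vanishes on vectors
orthogonal to `x` and so has the form `K x xᵀ + x xᵀ Kᵀ`. -/
theorem exists_lindbladMap_of_isSumSq_qForm {m : ℕ} (hm : m ≠ 0)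
    (A : symMat (m + 1) →ₗ[ℝ] symMat (m + 1)) (hA : IsSumSq (qForm A)) :
    ∃ (N : ℕ) (B : Fin N → Matrix (Fin (m + 1)) (Fin (m + 1)) ℝ)
      (K : Matrix (Fin (m + 1)) (Fin (m + 1)) ℝ), ∀ S, lindbladMap B K S.1 = (A S).1 := by
  obtain ⟨N, f, hf⟩ := hA.exists_sum_mul_self
  have hsum : ∀ x (α : Fin m → ℝ), psiVec x α ⬝ᵥ (A (rankOne x)).1 *ᵥ psiVec x α =
      ∑ i, eval (Sum.elim x α : Fin (m + 1) ⊕ Fin (m + 1 - 1) → ℝ) (f i) ^ 2 := by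
    intro x α
    rw [← eval_qForm, hf]
    simp [sq]
  have hB : ∀ i, ∃ B : Matrix (Fin (m + 1)) (Fin (m + 1)) ℝ, ∀ x (α : Fin m → ℝ),
      eval (Sum.elim x α : Fin (m + 1) ⊕ Fin (m + 1 - 1) → ℝ) (f i) = psiVec x α ⬝ᵥ B *ᵥ x := by
    refine fun i => exists_matrix_of_sq_le A (f i) fun x α => ?_
    rw [hsum]
    exact Finset.single_le_sum (f := fun i =>
      eval (Sum.elim x α : Fin (m + 1) ⊕ Fin (m + 1 - 1) → ℝ) (f i) ^ 2)
      (fun i _ => sq_nonneg _) (Finset.mem_univ i)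
  choose B hB using hB
  let D : Fin (m + 1) → Fin (m + 1) → QuadraticForm ℝ (Fin (m + 1) → ℝ) := fun j l =>
    ∑ a, ∑ b, (A (symUnit a b)).1 j l • QuadraticMap.proj a b -
      ∑ i, QuadraticMap.linMulLin (LinearMap.proj j ∘ₗ (B i).mulVecLin)
        (LinearMap.proj l ∘ₗ (B i).mulVecLin)
  have hD : ∀ x, (Matrix.of fun j l => D j l x) =
      (A (rankOne x)).1 - ∑ i, Matrix.vecMulVec (B i *ᵥ x) (B i *ᵥ x) := by
    intro x
    ext j l
    rw [rankOne_eq_sum]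
    simp [D, Matrix.sum_apply, Matrix.vecMulVec_apply, mul_comm]
  obtain ⟨K, hK⟩ := exists_eq_symm_product hm D (fun j l => by
      have hs : ∀ S, (A S).1 j l = (A S).1 l j := fun S => congrFun (congrFun (A S).2 l) j
      ext x
      simp [D, hs, mul_comm]) fun x α => by
    rw [hD, Matrix.sub_mulVec, dotProduct_sub, hsum, sub_eq_zero, Matrix.sum_mulVec,
      dotProduct_sum]
    refine Finset.sum_congr rfl fun i _ => ?_
    rw [hB, Matrix.vecMulVec_mulVec, op_smul_eq_smul, dotProduct_smul, sq, smul_eq_mul,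
      dotProduct_comm (B i *ᵥ x)]
  refine ⟨N, B, K, fun S => ?_⟩
  suffices hlin : lindbladMap B K ∘ₗ (symMat (m + 1)).subtype = (symMat (m + 1)).subtype ∘ₗ A from
    LinearMap.congr_fun hlin S
  refine symMat_linearMap_ext fun x => ?_
  have h1 : (A (rankOne x)).1 = (Matrix.of fun j l => D j l x) +
      ∑ i, Matrix.vecMulVec (B i *ᵥ x) (B i *ᵥ x) := by rw [hD]; abel
  have h2 : (Matrix.of fun j l => D j l x) =
      Matrix.vecMulVec (K *ᵥ x) x + Matrix.vecMulVec x (K *ᵥ x) := by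
    ext j l
    simp [hK, Matrix.vecMulVec_apply]
  change lindbladMap B K (Matrix.vecMulVec x x) = (A (rankOne x)).1
  rw [h1, h2, lindbladMap_apply]
  simp only [Matrix.mul_vecMulVec, Matrix.vecMulVec_mul, Matrix.vecMul_transpose]
  abel

theorem mainTheorem5 (n : ℕ) (hn : 2 ≤ n) (A : symMat n →ₗ[ℝ] symMat n) :
    List.TFAE [
      ∃ Φ : Matrix (Fin n) (Fin n) ℝ →ₗ[ℝ] Matrix (Fin n) (Fin n) ℝ,
        IsCompletelyCrossPositive Φ ∧ ∀ S : symMat n, Φ S.1 = (A S).1,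
      ∃ s : MvPolynomial (Fin n ⊕ Fin n) ℝ, IsSumSq s ∧ pForm A - s ∈ orthIdeal n,
      IsSumSq (qForm A)] := by
  obtain ⟨m, rfl⟩ : ∃ m, n = m + 1 := ⟨n - 1, by omega⟩
  tfae_have 1 → 2 := fun ⟨Φ, hΦ, hA⟩ => exists_isSumSq_sub_mem_orthIdeal hn hΦ hA
  tfae_have 2 → 3 := by
    rintro ⟨s, hs, hr⟩
    have h := aeval_psi_eq_zero_of_mem_orthIdeal hr
    rw [map_sub, sub_eq_zero] at h
    rw [qForm, h]
    obtain ⟨N, f, rfl⟩ := hs.exists_sum_mul_self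
    simp only [map_sum, map_mul]
    exact .sum_mul_self _ _
  tfae_have 3 → 1 := by
    intro h
    obtain ⟨N, B, K, hBK⟩ := exists_lindbladMap_of_isSumSq_qForm (by omega) A h
    exact ⟨_, isCompletelyCrossPositive_lindbladMap B K, hBK⟩
  tfae_finish
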